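/- Let $n$ be a natural number, let $\mathbb J=\begin{bmatrix}0&I_n\\-I_n&0\end{bmatrix}$ and let $Sp(2n,\mathbb R)$ be the group of real $2n\times 2n$ matrices $S$ with $S^T\mathbb J S=\mathbb J$. For $\mathbf d\in\mathbb R^n$ put $D=\mathrm{diag}(\mathbf d)$ and $\hat D=\begin{bmatrix}D&0\\0&D\end{bmatrix}$. Let $PH_n$ be the set of linear port-Hamiltonian systems in normal form $\dot{\mathbf z}=\mathbb JQ\mathbf z+Bu$, $y=B^TQ\mathbf z$, identified with their parameters $(Q,B)$, where $Q\in\mathbb R^{2n\times 2n}$ is symmetric positive definite and $B\in\mathbb R^{2n}$, with the subspace topology. Write $(Q_1,B_1)\sim_{sys}(Q_2,B_2)$ if the two systems are linearly system isomorphic, i.e. there is an invertible matrix $L$ with $L\mathbb JQ_1=\mathbb JQ_2L$, $LB_1=B_2$ and $B_1^TQ_1=B_2^TQ_2L$. Let $\Theta_{CH_n}=\{(\mathbf d,\mathbf v)\in\mathbb R^n\times\mathbb R^{2n} : d_i>0 \text{ for all } i\}$ with the subspace topology. Write $(\mathbf d_1,\mathbf v_1)\sim_\star(\mathbf d_2,\mathbf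 v_2)$ if there are an $n\times n$ permutation matrix $P_\sigma$ and an invertible $2n\times 2n$ matrix $A$ such that, with $P=\begin{bmatrix}P_\sigma&0\\0&P_\sigma\end{bmatrix}$, one has $P\hat D_1P^T=\hat D_2$, $A^T\hat D_1A\mathbf v_1=\hat D_1\mathbf v_1$, $A\mathbb J\hat D_1=\mathbb J\hat D_1A$ and $\mathbf v_2=PA\mathbf v_1$. Both $\sim_{sys}$ and $\sim_\star$ are equivalence relations. For $S\in Sp(2n,\mathbb R)$ let $\varphi_S\circ\theta_{CH_n}:\Theta_{CH_n}\to PH_n$ denote the map $(\mathbf d,\mathbf v)\mapsto(S^T\hat DS,\,S^{-1}\mathbf v)$. Theorem. For every $S\in Sp(2n,\mathbb R)$, $(\mathbf d_1,\mathbf v_1)\sim_\star(\mathbf d_2,\mathbf v_2)$ implies that the images of these pairs under $\varphi_S\circ\theta_{CH_n}$ are $\sim_{sys}$-equivalent, so that $\varphi_S\circ\theta_{CH_n}$ descends to a map $\Phi:\Theta_{CH_n}/{\sim_\star}\to PH_n/{\sim_{sys}}$. The map $\Phi$ is the same for all $S\in Sp(2n,\mathbb R)$ and is given by $\Phi([\mathbf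 d,\mathbf v]_\star)=[\hat D,\mathbf v]_{sys}$. It is a bijection, and a homeomorphism for the quotient topologies. -/

import Mathlib

open Matrix

namespace PortHam

/-- A state-space system `z' = F(z, u)`, `y = h(z)`. -/
structure StateSpaceSystem (Z U Y : Type*) where
  /-- the state map `F` -/
  stateMap : Z → U → Z
  /-- the observation (readout) map `h` -/
  readout : Z → Y

/-- System morphisms: system equivariance and readout invariance. -/
def IsSystemMorphism {Z₁ Z₂ U Y : Type*} (s₁ : StateSpaceSystem Z₁ U Y)
    (s₂ : StateSpaceSystem Z₂ U Y) (f : Z₁ → Z₂) : Prop :=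
  (∀ z u, f (s₁.stateMap z u) = s₂.stateMap (f z) u) ∧ ∀ z, s₁.readout z = s₂.readout (f z)

/-- Linear system isomorphism: an invertible linear map which is a system morphism and whose
inverse is a system morphism. -/
def LinearlyIsomorphic {Z₁ Z₂ U Y : Type*} [AddCommGroup Z₁] [Module ℝ Z₁]
    [AddCommGroup Z₂] [Module ℝ Z₂] (s₁ : StateSpaceSystem Z₁ U Y)
    (s₂ : StateSpaceSystem Z₂ U Y) : Prop :=
  ∃ f : Z₁ ≃ₗ[ℝ] Z₂, IsSystemMorphism s₁ s₂ f ∧ IsSystemMorphism s₂ s₁ f.symm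

/-- The index set of the coordinates of `ℝ²ⁿ`, split into two blocks of length `n`. -/
abbrev Idx (n : ℕ) : Type := Fin n ⊕ Fin n

/-- The canonical symplectic matrix `[[0, I], [-I, 0]]` (minus Mathlib's `Matrix.J`). -/
def JJ (n : ℕ) : Matrix (Idx n) (Idx n) ℝ := fromBlocks 0 1 (-1) 0

/-- Mathlib's symplectic group is the group of all `S` with `Sᵀ 𝕁 S = 𝕁`. -/
theorem mem_symplecticGroup_iff {n : ℕ} (S : Matrix (Idx n) (Idx n) ℝ) :
    S ∈ symplecticGroup (Fin n) ℝ ↔ Sᵀ * JJ n * S = JJ n := by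
  have h : JJ n = -J (Fin n) ℝ := by
    simp [JJ, J, fromBlocks_neg]
  rw [SymplecticGroup.mem_iff', h]
  simp

/-- The matrix `diag(D, D)` with `D = diag(d)`. -/
def dblDiag {n : ℕ} (d : Fin n → ℝ) : Matrix (Idx n) (Idx n) ℝ :=
  fromBlocks (diagonal d) 0 0 (diagonal d)

/-- The matrix `diag(P_σ, P_σ)` for the permutation matrix `P_σ` of `σ`. -/
def dblPerm {n : ℕ} (σ : Equiv.Perm (Fin n)) : Matrix (Idx n) (Idx n) ℝ :=
  fromBlocks (σ.permMatrix ℝ) 0 0 (σ.permMatrix ℝ)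

/-- The parameters `(Q, B)`, `Q` symmetric positive definite and `B ∈ ℝ²ⁿ`, of the linear
port-Hamiltonian systems in normal form, with the topology as a subspace of matrices × vectors. -/
abbrev PH (n : ℕ) : Type :=
  {x : Matrix (Idx n) (Idx n) ℝ × (Idx n → ℝ) // x.1.PosDef}

/-- The port-Hamiltonian system `z' = 𝕁 Q z + B u`, `y = Bᵀ Q z` of the parameters `(Q, B)`. -/
def PH.system {n : ℕ} (x : PH n) : StateSpaceSystem (Idx n → ℝ) ℝ ℝ where
  stateMap z u := (JJ n * x.1.1) *ᵥ z + u • x.1.2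
  readout z := (x.1.2 ᵥ* x.1.1) ⬝ᵥ z

/-- System isomorphism of port-Hamiltonian systems. -/
def SimSys {n : ℕ} (x y : PH n) : Prop := LinearlyIsomorphic x.system y.system

/-- The parameters `(d, v)` with `d ∈ ℝⁿ`, all `dᵢ > 0`, and `v ∈ ℝ²ⁿ`, with the subspace
topology. -/
abbrev ThetaCH (n : ℕ) : Type :=
  {p : (Fin n → ℝ) × (Idx n → ℝ) // ∀ i, 0 < p.1 i}

/-- The relation `∼⋆` on the parameters `(d, v)`. -/
def SimStar {n : ℕ} (p q : ThetaCH n) : Prop :=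
  ∃ (σ : Equiv.Perm (Fin n)) (A : Matrix (Idx n) (Idx n) ℝ), IsUnit A ∧
    dblPerm σ * dblDiag p.1.1 * (dblPerm σ)ᵀ = dblDiag q.1.1 ∧
    (Aᵀ * dblDiag p.1.1 * A) *ᵥ p.1.2 = dblDiag p.1.1 *ᵥ p.1.2 ∧
    A * (JJ n * dblDiag p.1.1) = (JJ n * dblDiag p.1.1) * A ∧
    q.1.2 = (dblPerm σ * A) *ᵥ p.1.2

/-- The matrix form of system isomorphism:
`L 𝕁 Q₁ = 𝕁 Q₂ L`, `L B₁ = B₂`, `B₁ᵀ Q₁ = B₂ᵀ Q₂ L` for an invertible `L`. -/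
theorem simSys_iff {n : ℕ} (x y : PH n) :
    SimSys x y ↔ ∃ L : Matrix (Idx n) (Idx n) ℝ, IsUnit L ∧
      L * (JJ n * x.1.1) = (JJ n * y.1.1) * L ∧ L *ᵥ x.1.2 = y.1.2 ∧
      x.1.2 ᵥ* x.1.1 = (y.1.2 ᵥ* y.1.1) ᵥ* L := by
  constructor
  · rintro ⟨f, ⟨h1, h2⟩, -⟩
    have hf : ∀ z, f z = LinearMap.toMatrix' f.toLinearMap *ᵥ z := fun z => by
      rw [LinearMap.toMatrix'_mulVec]; rfl
    refine ⟨LinearMap.toMatrix' f.toLinearMap, ?_, ?_, ?_, ?_⟩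
    · exact LinearEquiv.isUnit_det' f |>.elim fun u hu =>
        (Matrix.isUnit_iff_isUnit_det _).2 (by
          rw [LinearMap.det_toMatrix']; exact ⟨u, hu⟩)
    · apply Matrix.ext_of_mulVec_single
      intro i
      have := h1 (Pi.single i 1) 0
      simp only [PH.system, zero_smul, add_zero] at this
      rw [hf, hf, mulVec_mulVec, mulVec_mulVec] at this
      exact this
    · have := h1 0 1
      simp only [PH.system, mulVec_zero, map_zero, zero_add, one_smul] at this
      rw [hf] at this
      exact this
    · apply dotProduct_eq
      intro z
      have := h2 z
      simp only [PH.system] at this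
      rw [hf, dotProduct_mulVec] at this
      exact this
  · rintro ⟨L, hL, h1, h2, h3⟩
    have hd := (Matrix.isUnit_iff_isUnit_det _).1 hL
    have e1 : L * L⁻¹ = 1 := mul_nonsing_inv L hd
    have e2 : L⁻¹ * L = 1 := nonsing_inv_mul L hd
    have k1 : L⁻¹ * (JJ n * y.1.1) = (JJ n * x.1.1) * L⁻¹ := by
      calc L⁻¹ * (JJ n * y.1.1) = L⁻¹ * ((JJ n * y.1.1) * L) * L⁻¹ := by
            rw [Matrix.mul_assoc, Matrix.mul_assoc, e1, Matrix.mul_one]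
        _ = (L⁻¹ * L) * (JJ n * x.1.1) * L⁻¹ := by rw [← h1]; simp only [Matrix.mul_assoc]
        _ = _ := by rw [e2, Matrix.one_mul]
    have k2 : L⁻¹ *ᵥ y.1.2 = x.1.2 := by rw [← h2, mulVec_mulVec, e2, one_mulVec]
    have k3 : y.1.2 ᵥ* y.1.1 = (x.1.2 ᵥ* x.1.1) ᵥ* L⁻¹ := by
      rw [h3, vecMul_vecMul, e1, vecMul_one]
    obtain ⟨f, hf, hg⟩ : ∃ f : (Idx n → ℝ) ≃ₗ[ℝ] (Idx n → ℝ),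
        (∀ z, f z = L *ᵥ z) ∧ ∀ z, f.symm z = L⁻¹ *ᵥ z :=
      ⟨LinearEquiv.ofLinearMap (Matrix.mulVecLin L) (Matrix.mulVecLin L⁻¹)
        (by rw [← Matrix.mulVecLin_mul, e1, Matrix.mulVecLin_one])
        (by rw [← Matrix.mulVecLin_mul, e2, Matrix.mulVecLin_one]),
        fun _ => rfl, fun _ => rfl⟩
    refine ⟨f, ⟨fun z u => ?_, fun z => ?_⟩, fun z u => ?_, fun z => ?_⟩
    · rw [hf, hf]
      simp only [PH.system, mulVec_add, mulVec_smul, h2]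
      rw [mulVec_mulVec, h1, ← mulVec_mulVec]
    · rw [hf]
      simp only [PH.system]
      rw [dotProduct_mulVec, ← h3]
    · rw [hg, hg]
      simp only [PH.system, mulVec_add, mulVec_smul, k2]
      rw [mulVec_mulVec, k1, ← mulVec_mulVec]
    · rw [hg]
      simp only [PH.system]
      rw [dotProduct_mulVec, ← k3]

theorem simSys_equivalence (n : ℕ) : Equivalence (SimSys (n := n)) where
  refl x := ⟨LinearEquiv.refl ℝ _, ⟨fun _ _ => rfl, fun _ => rfl⟩, fun _ _ => rfl, fun _ => rfl⟩
  symm := fun ⟨f, h, k⟩ => ⟨f.symm, k, h⟩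
  trans := fun ⟨f, h, k⟩ ⟨g, h', k'⟩ => ⟨f.trans g,
    ⟨fun z u => by simp [h.1, h'.1], fun z => by simp [h.2, h'.2]⟩,
    fun z u => by simp [k.1, k'.1], fun z => by simp [k.2, k'.2]⟩

theorem dblPerm_one (n : ℕ) : dblPerm (1 : Equiv.Perm (Fin n)) = 1 := by
  have : (1 : Equiv.Perm (Fin n)).permMatrix ℝ = 1 := Matrix.permMatrix_one
  rw [dblPerm, this, fromBlocks_one]

theorem dblPerm_mul {n : ℕ} (σ τ : Equiv.Perm (Fin n)) :
    dblPerm (σ * τ) = dblPerm τ * dblPerm σ := by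
  simp [dblPerm, fromBlocks_multiply, Matrix.permMatrix_mul]

theorem dblPerm_transpose {n : ℕ} (σ : Equiv.Perm (Fin n)) :
    (dblPerm σ)ᵀ = dblPerm σ⁻¹ := by
  simp [dblPerm, fromBlocks_transpose, Matrix.transpose_permMatrix]

theorem dblPerm_transpose_mul {n : ℕ} (σ : Equiv.Perm (Fin n)) :
    (dblPerm σ)ᵀ * dblPerm σ = 1 := by
  rw [dblPerm_transpose, ← dblPerm_mul, mul_inv_cancel, dblPerm_one]

theorem dblPerm_mul_transpose {n : ℕ} (σ : Equiv.Perm (Fin n)) :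
    dblPerm σ * (dblPerm σ)ᵀ = 1 := by
  rw [dblPerm_transpose, ← dblPerm_mul, inv_mul_cancel, dblPerm_one]

theorem dblPerm_JJ {n : ℕ} (σ : Equiv.Perm (Fin n)) : dblPerm σ * JJ n = JJ n * dblPerm σ := by
  simp [dblPerm, JJ, fromBlocks_multiply]

theorem simStar_equivalence (n : ℕ) : Equivalence (SimStar (n := n)) where
  refl p := ⟨1, 1, isUnit_one, by simp [dblPerm_one], by simp, by simp, by simp [dblPerm_one]⟩
  symm := by
    rintro ⟨⟨d, v⟩, hp⟩ ⟨⟨e, w⟩, hq⟩ ⟨σ, A, hA, h1, h2, h3, h4⟩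
    dsimp only at h1 h2 h3 h4
    have hd := (Matrix.isUnit_iff_isUnit_det _).1 hA
    have e1 : A * A⁻¹ = 1 := mul_nonsing_inv A hd
    have e2 : A⁻¹ * A = 1 := nonsing_inv_mul A hd
    have e3 : (A⁻¹)ᵀ * Aᵀ = 1 := by rw [← transpose_mul, e1, transpose_one]
    have p1 := dblPerm_transpose_mul σ
    have p2 := dblPerm_mul_transpose σ
    have pJ := dblPerm_JJ σ
    refine ⟨σ⁻¹, dblPerm σ * A⁻¹ * (dblPerm σ)ᵀ, ?_⟩
    dsimp only
    rw [← dblPerm_transpose σ]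
    clear hp hq
    generalize dblPerm σ = P at *
    generalize dblDiag d = D at *
    generalize dblDiag e = E at *
    generalize JJ n = JM at *
    have c1 (X : Matrix (Idx n) (Idx n) ℝ) : Pᵀ * (P * X) = X := by
      rw [← Matrix.mul_assoc, p1, Matrix.one_mul]
    have c2 (X : Matrix (Idx n) (Idx n) ℝ) : P * (Pᵀ * X) = X := by
      rw [← Matrix.mul_assoc, p2, Matrix.one_mul]
    have c3 (X : Matrix (Idx n) (Idx n) ℝ) : A⁻¹ * (A * X) = X := by
      rw [← Matrix.mul_assoc, e2, Matrix.one_mul]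
    have h3' : A⁻¹ * (JM * D) = JM * D * A⁻¹ := by
      calc A⁻¹ * (JM * D) = A⁻¹ * (JM * D * A) * A⁻¹ := by
            simp only [Matrix.mul_assoc, e1, Matrix.mul_one]
        _ = _ := by rw [← h3, c3]
    have hP : IsUnit P := ⟨⟨P, Pᵀ, p2, p1⟩, rfl⟩
    have hPt : IsUnit Pᵀ := ⟨⟨Pᵀ, P, p1, p2⟩, rfl⟩
    have hAi : IsUnit A⁻¹ := ⟨⟨A⁻¹, A, e2, e1⟩, rfl⟩
    have pJ' : JM * P = P * JM := pJ.symm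
    have c4 (X : Matrix (Idx n) (Idx n) ℝ) : JM * (P * X) = P * (JM * X) := by
      rw [← Matrix.mul_assoc, pJ', Matrix.mul_assoc]
    refine ⟨(hP.mul hAi).mul hPt, ?_, ?_, ?_, ?_⟩
    · rw [← h1, transpose_transpose]
      simp only [Matrix.mul_assoc, p1, c1, Matrix.mul_one]
    · rw [h4, ← h1]
      simp only [transpose_mul, transpose_transpose, mulVec_mulVec, Matrix.mul_assoc, c1, e2,
        Matrix.mul_one]
      have h5 : (A⁻¹)ᵀ *ᵥ (D *ᵥ v) = (D * A) *ᵥ v := by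
        rw [← h2, mulVec_mulVec]
        congr 1
        rw [Matrix.mul_assoc, ← Matrix.mul_assoc, e3, Matrix.one_mul]
      rw [← mulVec_mulVec, ← mulVec_mulVec, h5, mulVec_mulVec]
    · rw [← h1]
      simp only [Matrix.mul_assoc, c1, c4] at h3' ⊢
      congr 1
      rw [← Matrix.mul_assoc, ← Matrix.mul_assoc, Matrix.mul_assoc A⁻¹, h3']
      simp only [Matrix.mul_assoc]
    · rw [h4, mulVec_mulVec]
      simp only [Matrix.mul_assoc, c1, e2, one_mulVec]
  trans := by
    rintro ⟨⟨d, v⟩, hp⟩ ⟨⟨e, w⟩, hq⟩ ⟨⟨g, x⟩, hr⟩ ⟨σ, A, hA, h1, h2, h3, h4⟩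
      ⟨τ, B, hB, k1, k2, k3, k4⟩
    dsimp only at h1 h2 h3 h4 k1 k2 k3 k4
    have p1 := dblPerm_transpose_mul σ
    have p2 := dblPerm_mul_transpose σ
    have pJ := dblPerm_JJ σ
    refine ⟨σ * τ, (dblPerm σ)ᵀ * B * dblPerm σ * A, ?_⟩
    dsimp only
    rw [dblPerm_mul σ τ]
    clear hp hq hr
    generalize dblPerm σ = P at *
    generalize dblPerm τ = T at *
    generalize dblDiag d = D at *
    generalize dblDiag e = E at *
    generalize dblDiag g = G at *
    generalize JJ n = JM at *
    have c1 (X : Matrix (Idx n) (Idx n) ℝ) : Pᵀ * (P * X) = X := by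
      rw [← Matrix.mul_assoc, p1, Matrix.one_mul]
    have c2 (X : Matrix (Idx n) (Idx n) ℝ) : P * (Pᵀ * X) = X := by
      rw [← Matrix.mul_assoc, p2, Matrix.one_mul]
    have hP : IsUnit P := ⟨⟨P, Pᵀ, p2, p1⟩, rfl⟩
    have hPt : IsUnit Pᵀ := ⟨⟨Pᵀ, P, p1, p2⟩, rfl⟩
    have c4 (X : Matrix (Idx n) (Idx n) ℝ) : JM * (P * X) = P * (JM * X) := by
      rw [← Matrix.mul_assoc, ← pJ, Matrix.mul_assoc]
    refine ⟨((hPt.mul hB).mul hP).mul hA, ?_, ?_, ?_, ?_⟩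
    · rw [← k1, ← h1]
      simp only [transpose_mul, Matrix.mul_assoc]
    · subst h4
      have s1 : ((Pᵀ * B * P * A)ᵀ * D * (Pᵀ * B * P * A)) *ᵥ v
          = (Aᵀ * Pᵀ) *ᵥ ((Bᵀ * E * B) *ᵥ ((P * A) *ᵥ v)) := by
        rw [← h1]
        simp only [transpose_mul, transpose_transpose, mulVec_mulVec, Matrix.mul_assoc]
      rw [s1, k2, ← h1]
      simp only [mulVec_mulVec, Matrix.mul_assoc, c1]
      simpa only [Matrix.mul_assoc] using h2
    · have q1 : E * P = P * D := by rw [← h1]; simp only [Matrix.mul_assoc, p1, Matrix.mul_one]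
      have q3 : P * (JM * D) = JM * E * P := by
        rw [Matrix.mul_assoc JM, q1, c4]
      have q2 : JM * D = Pᵀ * (JM * E * P) := by rw [← q3, c1]
      calc Pᵀ * B * P * A * (JM * D) = Pᵀ * B * P * (JM * D * A) := by
            rw [Matrix.mul_assoc, h3]
        _ = Pᵀ * B * (P * (JM * D)) * A := by simp only [Matrix.mul_assoc]
        _ = Pᵀ * (B * (JM * E)) * P * A := by rw [q3]; simp only [Matrix.mul_assoc]
        _ = (Pᵀ * (JM * E * P)) * (Pᵀ * B * P * A) := by
            rw [k3]; simp only [Matrix.mul_assoc, c2]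
        _ = JM * D * (Pᵀ * B * P * A) := by rw [← q2]
    · rw [k4, h4, mulVec_mulVec]
      simp only [Matrix.mul_assoc, c2]

/-- The equivalence relation `∼sys` on port-Hamiltonian systems. -/
instance simSysSetoid (n : ℕ) : Setoid (PH n) := ⟨SimSys, simSys_equivalence n⟩

/-- The equivalence relation `∼⋆` on the parameters `(d, v)`. -/
instance simStarSetoid (n : ℕ) : Setoid (ThetaCH n) := ⟨SimStar, simStar_equivalence n⟩

/-- `PH_n / ∼sys`, which carries the quotient topology. -/
abbrev PHQuot (n : ℕ) : Type := Quotient (simSysSetoid n)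

/-- `Θ_CH / ∼⋆`, which carries the quotient topology. -/
abbrev ThetaQuot (n : ℕ) : Type := Quotient (simStarSetoid n)

theorem dblDiag_posDef {n : ℕ} {d : Fin n → ℝ} (hd : ∀ i, 0 < d i) : (dblDiag d).PosDef := by
  rw [dblDiag, fromBlocks_diagonal]
  exact PosDef.diagonal (by rintro (i | i) <;> exact hd i)

theorem conj_posDef {n : ℕ} {d : Fin n → ℝ} (hd : ∀ i, 0 < d i)
    (S : symplecticGroup (Fin n) ℝ) :
    ((S : Matrix (Idx n) (Idx n) ℝ)ᵀ * dblDiag d * (S : Matrix (Idx n) (Idx n) ℝ)).PosDef := by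
  have h := (dblDiag_posDef hd).conjTranspose_mul_mul_same
    (B := (S : Matrix (Idx n) (Idx n) ℝ)) (mulVec_injective_of_isUnit
      ((isUnit_iff_isUnit_det _).2 (SymplecticGroup.symplectic_det S.2)))
  rwa [conjTranspose_eq_transpose_of_trivial] at h

/-- The composite `φ_S ∘ θ_CH`, i.e. `(d, v) ↦ (Sᵀ diag(D, D) S, S⁻¹ v)`. -/
noncomputable def phiTheta {n : ℕ} (S : symplecticGroup (Fin n) ℝ) (p : ThetaCH n) : PH n :=
  ⟨((S : Matrix (Idx n) (Idx n) ℝ)ᵀ * dblDiag p.1.1 * (S : Matrix (Idx n) (Idx n) ℝ),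
    (S : Matrix (Idx n) (Idx n) ℝ)⁻¹ *ᵥ p.1.2), conj_posDef p.2 S⟩

/-- The element `(diag(D, D), v)` of `PH_n`. -/
def diagPH {n : ℕ} (p : ThetaCH n) : PH n :=
  ⟨(dblDiag p.1.1, p.1.2), dblDiag_posDef p.2⟩

end PortHam

namespace PortHam

/-! The matrix `S` is itself a system isomorphism from `phiTheta S p` to `diagPH p`, because `S * JJ
n * Sᵀ = JJ n`. Modulo system isomorphism the choice of `S` therefore disappears, and every
assertion concerns `diagPH`.

Injectivity: an isomorphism `L` conjugates 𝕁D̂₁ to 𝕁D̂₂. Their squares are minus diag(D₁², D₁²) and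
minus diag(D₂², D₂²), so by positivity the parameters agree up to a permutation; removing that
permutation from `L` leaves the matrix `A` of `SimStar`. Surjectivity is Williamson's theorem,
`exists_williamson`.

Continuity of the inverse is the delicate point, since Williamson's `S` and `d` need not be unique
or depend continuously on `Q`. The map (d, S) ↦ SᵀD̂S is however proper onto the positive definite
matrices (`exists_tendsto_of_tendsto_williamson`): along an ultrafilter, arbitrary choices converge
to some Williamson data of the limit. Injectivity identifies the class of those data with the value
of the inverse at the limit. -/

/-! ### Reduction to the diagonal representatives -/

theorem dblDiag_eq {n : ℕ} (d : Fin n → ℝ) : dblDiag d = diagonal (Sum.elim d d) := by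
  rw [dblDiag, fromBlocks_diagonal]

theorem JJ_mul_dblDiag_comm {n : ℕ} (d : Fin n → ℝ) : JJ n * dblDiag d = dblDiag d * JJ n := by
  simp [JJ, dblDiag, fromBlocks_multiply, -fromBlocks_diagonal]

theorem JJ_mul_JJ (n : ℕ) : JJ n * JJ n = -1 := by
  rw [JJ, fromBlocks_multiply]; simp [← fromBlocks_one, fromBlocks_neg]

theorem isUnit_JJ (n : ℕ) : IsUnit (JJ n) :=
  ⟨⟨JJ n, -JJ n, by simp [JJ_mul_JJ], by simp [JJ_mul_JJ]⟩, rfl⟩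

theorem JJ_transpose (n : ℕ) : (JJ n)ᵀ = -JJ n := by
  simp [JJ, fromBlocks_transpose, fromBlocks_neg]

theorem JJ_mul_dblDiag_sq {n : ℕ} (d : Fin n → ℝ) :
    (JJ n * dblDiag d) * (JJ n * dblDiag d) = -dblDiag (fun i => d i ^ 2) := by
  nth_rw 1 [JJ_mul_dblDiag_comm]
  rw [Matrix.mul_assoc, ← Matrix.mul_assoc (JJ n), JJ_mul_JJ]
  simp [dblDiag, pow_two]

theorem mul_JJ_mul_transpose {n : ℕ} {S : Matrix (Idx n) (Idx n) ℝ}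
    (hS : S ∈ symplecticGroup (Fin n) ℝ) : S * JJ n * Sᵀ = JJ n := by
  have h : JJ n = -J (Fin n) ℝ := by simp [JJ, J, fromBlocks_neg]
  rw [h]
  simpa using SymplecticGroup.mem_iff.1 hS

theorem isUnit_of_mem_symplecticGroup {n : ℕ} {S : Matrix (Idx n) (Idx n) ℝ}
    (hS : S ∈ symplecticGroup (Fin n) ℝ) : IsUnit S :=
  (isUnit_iff_isUnit_det _).2 (SymplecticGroup.symplectic_det hS)

/-- `S` itself is a system isomorphism. -/
theorem simSys_phiTheta_diagPH {n : ℕ} (S : symplecticGroup (Fin n) ℝ) (p : ThetaCH n) :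
    SimSys (phiTheta S p) (diagPH p) := by
  obtain ⟨S, hS⟩ := S
  have hd := SymplecticGroup.symplectic_det hS
  have hJ := mul_JJ_mul_transpose hS
  refine (simSys_iff _ _).2 ⟨S, isUnit_of_mem_symplecticGroup hS, ?_, ?_, ?_⟩
  · simp only [phiTheta, diagPH]
    rw [← Matrix.mul_assoc, ← Matrix.mul_assoc, ← Matrix.mul_assoc, hJ]
  · simp [phiTheta, diagPH, mulVec_mulVec, mul_nonsing_inv S hd]
  · simp only [phiTheta, diagPH]
    rw [← vecMul_transpose, vecMul_vecMul, vecMul_vecMul, ← Matrix.mul_assoc, ← Matrix.mul_assoc,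
      ← transpose_mul, mul_nonsing_inv S hd]
    simp

theorem dblDiag_transpose {n : ℕ} (d : Fin n → ℝ) : (dblDiag d)ᵀ = dblDiag d := by
  simp [dblDiag]

/-- The isomorphism is L = PA. In the readout condition LᵀD̂₂L collapses to AᵀD̂₁A, so the condition
is the transpose of AᵀD̂₁Av₁ = D̂₁v₁. -/
theorem SimStar.simSys_diagPH {n : ℕ} {p q : ThetaCH n} (h : SimStar p q) :
    SimSys (diagPH p) (diagPH q) := by
  obtain ⟨σ, A, hA, h1, h2, h3, h4⟩ := h
  have p1 := dblPerm_transpose_mul σ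
  have p2 := dblPerm_mul_transpose σ
  have pJ := dblPerm_JJ σ
  refine (simSys_iff _ _).2 ⟨dblPerm σ * A, IsUnit.mul ⟨⟨_, _, p2, p1⟩, rfl⟩ hA, ?_, ?_, ?_⟩
  · simp only [diagPH]
    rw [Matrix.mul_assoc, h3, ← h1]
    simp only [← Matrix.mul_assoc, pJ]
    rw [Matrix.mul_assoc _ (dblPerm σ)ᵀ, p1, Matrix.mul_one]
  · simp only [diagPH, h4]
  · simp only [diagPH, h4]
    rw [← h1, ← vecMul_transpose, vecMul_vecMul, vecMul_vecMul]
    have : (dblPerm σ * A)ᵀ * (dblPerm σ * dblDiag p.1.1 * (dblPerm σ)ᵀ * (dblPerm σ * A))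
        = Aᵀ * dblDiag p.1.1 * A := by
      rw [transpose_mul]
      simp only [Matrix.mul_assoc]
      simp only [← Matrix.mul_assoc (dblPerm σ)ᵀ, p1, Matrix.one_mul]
    rw [← Matrix.mul_assoc] at this
    rw [← Matrix.mul_assoc, this, ← mulVec_transpose, ← mulVec_transpose]
    simp only [transpose_mul, transpose_transpose, dblDiag_transpose]
    rw [← Matrix.mul_assoc, h2]

/-! ### Injectivity: comparison of spectra -/

theorem roots_charpoly_dblDiag {n : ℕ} (d : Fin n → ℝ) :
    (dblDiag d).charpoly.roots = 2 • Finset.univ.val.map d := by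
  have h : (diagonal d).charpoly.roots = Finset.univ.val.map d := by
    rw [charpoly_diagonal]
    have := Polynomial.roots_multiset_prod_X_sub_C (Finset.univ.val.map d)
    rwa [Multiset.map_map] at this
  rw [dblDiag, charpoly_fromBlocks_zero₁₂, ← pow_two, Polynomial.roots_pow, h]

/-- Two families with the same multiset of values differ by a permutation. -/
theorem exists_perm_of_map_univ_eq {ι α : Type*} [Fintype ι] [DecidableEq α] {f g : ι → α}
    (h : Finset.univ.val.map f = Finset.univ.val.map g) :
    ∃ σ : Equiv.Perm ι, g = f ∘ σ := by
  -- Equal multiplicities give bijections between the fibres of `g` and `f`, which are then glued.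
  have hc (c : α) : Nonempty ({i // g i = c} ≃ {i // f i = c}) := by
    refine ⟨Fintype.equivOfCardEq ?_⟩
    have := congrArg (Multiset.count c) h
    simp only [Multiset.count_map, eq_comm (a := c)] at this
    rw [Fintype.card_subtype, Fintype.card_subtype]
    exact this.symm
  exact ⟨Equiv.ofFiberEquiv fun c => (hc c).some,
    funext fun i => (Equiv.ofFiberEquiv_map (fun c => (hc c).some) i).symm⟩

/-- If `𝕁 D̂` and `𝕁 Ê` are similar, then `d` and `e` agree up to a permutation. -/
theorem exists_perm_of_conj {n : ℕ} {d e : Fin n → ℝ} (hd : ∀ i, 0 < d i) (he : ∀ i, 0 < e i)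
    {L : Matrix (Idx n) (Idx n) ℝ} (hL : IsUnit L)
    (h : L * (JJ n * dblDiag d) = (JJ n * dblDiag e) * L) :
    ∃ σ : Equiv.Perm (Fin n), e = d ∘ σ := by
  -- Squaring replaces the imaginary spectrum ±i·d of 𝕁D̂ by a real diagonal matrix.
  have h2 : L * dblDiag (fun i => d i ^ 2) = dblDiag (fun i => e i ^ 2) * L := by
    have : L * ((JJ n * dblDiag d) * (JJ n * dblDiag d))
        = (JJ n * dblDiag e) * (JJ n * dblDiag e) * L := by
      rw [← Matrix.mul_assoc, h, Matrix.mul_assoc, h, Matrix.mul_assoc (JJ n * dblDiag e)]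
    rwa [JJ_mul_dblDiag_sq, JJ_mul_dblDiag_sq, Matrix.mul_neg, Matrix.neg_mul, neg_inj] at this
  have hc : (dblDiag fun i => d i ^ 2).charpoly = (dblDiag fun i => e i ^ 2).charpoly := by
    rw [← charpoly_units_conj hL.unit, IsUnit.unit_spec, h2, Matrix.mul_assoc,
      mul_nonsing_inv L ((isUnit_iff_isUnit_det _).1 hL), Matrix.mul_one]
  have hr := congrArg Polynomial.roots hc
  rw [roots_charpoly_dblDiag, roots_charpoly_dblDiag] at hr
  -- Each d i ^ 2 is counted once per diagonal block, so the factor 2 cancels.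
  obtain ⟨σ, hσ⟩ := exists_perm_of_map_univ_eq (nsmul_right_injective two_ne_zero hr)
  refine ⟨σ, funext fun i => ?_⟩
  exact (pow_left_inj₀ (he i).le (hd _).le two_ne_zero).1 (congrFun hσ i)

theorem dblPerm_conj {n : ℕ} (σ : Equiv.Perm (Fin n)) (d : Fin n → ℝ) :
    dblPerm σ * dblDiag d * (dblPerm σ)ᵀ = dblDiag (d ∘ σ) := by
  have h : σ.permMatrix ℝ * diagonal d * (σ.permMatrix ℝ)ᵀ = diagonal (d ∘ σ) := by
    rw [transpose_permMatrix, Equiv.Perm.permMatrix, PEquiv.toMatrix_toPEquiv_mul,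
      Equiv.Perm.permMatrix, PEquiv.mul_toMatrix_toPEquiv]
    ext i j
    simp [diagonal_apply, Equiv.Perm.inv_def]
  simp only [dblPerm, dblDiag, fromBlocks_transpose, fromBlocks_multiply]
  simp [h, -fromBlocks_diagonal, -transpose_permMatrix]

/-- With σ read off from the spectra, A = PᵀL commutes with 𝕁D̂₁ because PᵀD̂₂P = D̂₁ and P commutes
with 𝕁. Transposing the readout condition and inserting Lv₁ = v₂ gives the condition on AᵀD̂₁A. -/
theorem SimStar.of_simSys_diagPH {n : ℕ} {p q : ThetaCH n} (h : SimSys (diagPH p) (diagPH q)) :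
    SimStar p q := by
  obtain ⟨L, hL, h1, h2, h3⟩ := (simSys_iff _ _).1 h
  simp only [diagPH] at h1 h2 h3
  obtain ⟨σ, hσ⟩ := exists_perm_of_conj p.2 q.2 hL h1
  have p1 := dblPerm_transpose_mul σ
  have p2 := dblPerm_mul_transpose σ
  have pJ := dblPerm_JJ σ
  have hc := dblPerm_conj σ p.1.1
  rw [← hσ] at hc
  have hq : dblDiag p.1.1 = (dblPerm σ)ᵀ * dblDiag q.1.1 * dblPerm σ := by
    rw [← hc]
    simp only [Matrix.mul_assoc, p1, Matrix.mul_one]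
    rw [← Matrix.mul_assoc, p1, Matrix.one_mul]
  have c2 (X : Matrix (Idx n) (Idx n) ℝ) : dblPerm σ * ((dblPerm σ)ᵀ * X) = X := by
    rw [← Matrix.mul_assoc, p2, Matrix.one_mul]
  have hJ' : (dblPerm σ)ᵀ * JJ n = JJ n * (dblPerm σ)ᵀ := by
    rw [dblPerm_transpose, dblPerm_JJ]
  refine ⟨σ, (dblPerm σ)ᵀ * L, IsUnit.mul ⟨⟨_, _, p1, p2⟩, rfl⟩ hL, hc, ?_, ?_, ?_⟩
  · have e1 : ((dblPerm σ)ᵀ * L)ᵀ * dblDiag p.1.1 * ((dblPerm σ)ᵀ * L)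
        = Lᵀ * (dblDiag q.1.1 * L) := by
      rw [hq, transpose_mul, transpose_transpose]
      simp only [Matrix.mul_assoc, c2]
    rw [e1, ← mulVec_mulVec, ← mulVec_mulVec, h2, mulVec_transpose, ← dblDiag_transpose q.1.1,
      mulVec_transpose, ← h3, ← mulVec_transpose, dblDiag_transpose]
  · rw [Matrix.mul_assoc, h1]
    nth_rw 1 [hq]
    rw [← Matrix.mul_assoc, ← Matrix.mul_assoc, hJ']
    simp only [Matrix.mul_assoc, c2]
  · rw [← Matrix.mul_assoc, p2, Matrix.one_mul, h2]

/-! ### Normal form of skew operators -/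

section Skew
variable {V : Type*} [NormedAddCommGroup V] [InnerProductSpace ℝ V]

/-- A nonzero subspace which is invariant under an injective skew operator `K` contains an
orthonormal pair `x, y` spanning a `K`-invariant plane. -/
theorem exists_invariant_plane [FiniteDimensional ℝ V] (K : V →ₗ[ℝ] V)
    (hK : ∀ x y, inner ℝ (K x) y = -inner ℝ x (K y)) (hinj : Function.Injective K)
    (W : Submodule ℝ V) (hW : ∀ x ∈ W, K x ∈ W) (hne : W ≠ ⊥) :
    ∃ x ∈ W, ∃ y ∈ W, ∃ d : ℝ, 0 < d ∧ inner ℝ x x = (1 : ℝ) ∧ inner ℝ y y = (1 : ℝ) ∧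
      inner ℝ x y = (0 : ℝ) ∧ K x = -d • y ∧ K y = d • x := by
  have hnt : Nontrivial W := Submodule.nontrivial_iff_ne_bot.2 hne
  have hW2 : ∀ x ∈ W, (K ∘ₗ K) x ∈ W := fun x hx => hW _ (hW _ hx)
  -- K² is symmetric, so it has a real eigenvector in W; K need not have one. Which eigenvalue μ is
  -- obtained is irrelevant.
  have hsym : (K ∘ₗ K).IsSymmetric := fun x y => by simp [hK]
  obtain ⟨z, hz⟩ :=
    (hsym.restrict_invariant hW2).hasEigenvalue_iSup_of_finiteDimensional.exists_hasEigenvector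
  generalize (RCLike.ofReal _ : ℝ) = μ at hz
  have hz0 : (z : V) ≠ 0 := fun h => hz.2 (Subtype.ext h)
  have hz1 : K (K z) = μ • (z : V) := congrArg Subtype.val hz.apply_eq_smul
  obtain ⟨x, hxW, hx1, hx⟩ : ∃ x ∈ W, inner ℝ x x = (1 : ℝ) ∧ K (K x) = μ • x := by
    refine ⟨‖(z : V)‖⁻¹ • (z : V), W.smul_mem _ z.2, ?_, ?_⟩
    · rw [real_inner_self_eq_norm_sq, norm_smul, norm_inv, norm_norm,
        inv_mul_cancel₀ (norm_ne_zero_iff.2 hz0), one_pow]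
    · rw [map_smul, map_smul, hz1, smul_comm]
  have hKx : K x ≠ 0 := fun h => by
    rw [(map_eq_zero_iff K hinj).1 h, inner_zero_left] at hx1
    exact zero_ne_one hx1
  have hd : 0 < ‖K x‖ := norm_pos_iff.2 hKx
  have hμ : μ = -‖K x‖ ^ 2 := by
    rw [← real_inner_self_eq_norm_sq, hK, hx, inner_smul_right, hx1]; ring
  have hsk : inner ℝ x (K x) = (0 : ℝ) := by
    have := hK x x
    rw [real_inner_comm] at this
    linarith
  -- The plane is spanned by x and Kx; the sign of y matches the block signs of 𝕁D̂.
  refine ⟨x, hxW, -‖K x‖⁻¹ • K x, W.smul_mem _ (hW x hxW), ‖K x‖, hd, hx1, ?_, ?_, ?_, ?_⟩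
  · rw [inner_smul_left, inner_smul_right, real_inner_self_eq_norm_sq]
    simp only [RCLike.conj_to_real]
    field_simp
  · rw [inner_smul_right, hsk, mul_zero]
  · rw [smul_smul, neg_mul_neg, mul_inv_cancel₀ hd.ne', one_smul]
  · rw [map_smul, hx, smul_smul, hμ]
    congr 1
    field_simp

/-- Orthonormal normal form of an injective skew operator, for families of a prescribed length. -/
theorem exists_orthonormal_skew [FiniteDimensional ℝ V] (K : V →ₗ[ℝ] V)
    (hK : ∀ x y, inner ℝ (K x) y = -inner ℝ x (K y)) (hinj : Function.Injective K)
    (k : ℕ) (hk : 2 * k ≤ Module.finrank ℝ V) :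
    ∃ (a b : Fin k → V) (d : Fin k → ℝ), Orthonormal ℝ (Sum.elim a b) ∧ (∀ i, 0 < d i) ∧
      (∀ i, K (a i) = -d i • b i) ∧ ∀ i, K (b i) = d i • a i := by
  induction k with
  | zero => exact ⟨Fin.elim0, Fin.elim0, Fin.elim0, ⟨by simp, fun i => i.elim Fin.elim0 Fin.elim0⟩,
      fun i => i.elim0, fun i => i.elim0, fun i => i.elim0⟩
  | succ k ih =>
    obtain ⟨a, b, d, ho, hd, ha, hb⟩ := ih (by omega)
    set W : Submodule ℝ V := (Submodule.span ℝ (Set.range (Sum.elim a b)))ᗮ with hWdef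
    have hmem (x : V) : x ∈ W ↔ (∀ i, inner ℝ (a i) x = (0 : ℝ)) ∧
        ∀ i, inner ℝ (b i) x = (0 : ℝ) := by
      rw [hWdef, Submodule.mem_orthogonal]
      constructor
      · exact fun h => ⟨fun i => h _ (Submodule.subset_span ⟨Sum.inl i, rfl⟩),
          fun i => h _ (Submodule.subset_span ⟨Sum.inr i, rfl⟩)⟩
      · rintro ⟨h1, h2⟩ u hu
        induction hu using Submodule.span_induction with
        | mem u hu => obtain ⟨i | i, rfl⟩ := hu; exacts [h1 i, h2 i]
        | zero => exact inner_zero_left _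
        | add u v _ _ hu hv => rw [inner_add_left, hu, hv, add_zero]
        | smul c u _ hu => rw [inner_smul_left, hu, mul_zero]
    -- Skewness moves K onto the pairs already found, whose span is K-invariant.
    have hW : ∀ x ∈ W, K x ∈ W := by
      intro x hx
      rw [hmem] at hx ⊢
      refine ⟨fun i => ?_, fun i => ?_⟩
      · rw [← neg_eq_zero, ← hK, ha, inner_smul_left, hx.2, mul_zero]
      · rw [← neg_eq_zero, ← hK, hb, inner_smul_left, hx.1, mul_zero]
    -- Only 2k of at least 2(k + 1) dimensions are used so far.
    have hne : W ≠ ⊥ := by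
      intro h
      have h1 := Submodule.finrank_add_finrank_orthogonal
        (Submodule.span ℝ (Set.range (Sum.elim a b)))
      rw [← hWdef, h, finrank_bot, finrank_span_eq_card ho.linearIndependent] at h1
      simp at h1
      omega
    obtain ⟨x, hxW, y, hyW, c, hc, hxx, hyy, hxy, hKx, hKy⟩ :=
      exists_invariant_plane K hK hinj W hW hne
    rw [hmem] at hxW hyW
    have hyx : inner ℝ y x = (0 : ℝ) := by rw [real_inner_comm, hxy]
    have hxa (i) : inner ℝ x (a i) = (0 : ℝ) := by rw [real_inner_comm, hxW.1]
    have hxb (i) : inner ℝ x (b i) = (0 : ℝ) := by rw [real_inner_comm, hxW.2]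
    have hya (i) : inner ℝ y (a i) = (0 : ℝ) := by rw [real_inner_comm, hyW.1]
    have hyb (i) : inner ℝ y (b i) = (0 : ℝ) := by rw [real_inner_comm, hyW.2]
    classical
    rw [orthonormal_iff_ite] at ho
    refine ⟨Fin.cons x a, Fin.cons y b, Fin.cons c d, ?_, ?_, ?_, ?_⟩
    · have haa (i j) := ho (Sum.inl i) (Sum.inl j)
      have hab (i j) := ho (Sum.inl i) (Sum.inr j)
      have hba (i j) := ho (Sum.inr i) (Sum.inl j)
      have hbb (i j) := ho (Sum.inr i) (Sum.inr j)
      simp only [Sum.elim_inl, Sum.elim_inr, Sum.inl.injEq, Sum.inr.injEq, reduceCtorEq,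
        if_false] at haa hab hba hbb
      rw [orthonormal_iff_ite]
      rintro (i | i) (j | j) <;> refine Fin.cases ?_ (fun i => ?_) i <;>
        refine Fin.cases ?_ (fun j => ?_) j <;>
        simp [hxx, hyy, hxy, hyx, hxa, hxb, hya, hyb, hxW.1, hxW.2, hyW.1, hyW.2, haa, hab, hba,
          hbb, Fin.succ_ne_zero, (Fin.succ_ne_zero _).symm, -inner_self_eq_norm_sq_to_K]
    · exact fun i => Fin.cases hc hd i
    · exact fun i => Fin.cases hKx ha i
    · exact fun i => Fin.cases hKy hb i

end Skew

/-- Orthogonal normal form of an invertible skew-symmetric matrix. -/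
theorem exists_orthogonal_skew {n : ℕ} (K : Matrix (Idx n) (Idx n) ℝ) (hK : Kᵀ = -K)
    (hu : IsUnit K) : ∃ (U : Matrix (Idx n) (Idx n) ℝ) (d : Fin n → ℝ), (∀ i, 0 < d i) ∧
      Uᵀ * U = 1 ∧ K * U = U * (JJ n * dblDiag d) := by
  have hin (x y : EuclideanSpace ℝ (Idx n)) :
      inner ℝ x y = x.ofLp ⬝ᵥ y.ofLp := by
    rw [EuclideanSpace.inner_eq_star_dotProduct, star_trivial, dotProduct_comm]
  obtain ⟨a, b, d, ho, hd, ha, hb⟩ := exists_orthonormal_skew (toEuclideanLin K)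
    (fun x y => by
      rw [hin, hin, toLpLin_apply, toLpLin_apply, dotProduct_mulVec,
        ← mulVec_transpose, hK, neg_mulVec, neg_dotProduct, neg_neg])
    (fun x y h => by
      rw [toLpLin_apply, toLpLin_apply] at h
      exact WithLp.ofLp_injective _ (mulVec_injective_of_isUnit hu (WithLp.toLp_injective _ h)))
    n (by simp [two_mul])
  -- The columns of U are the vectors a i followed by the b i; K U = U 𝕁D̂ is then checked column by
  -- column.
  refine ⟨of fun r s => (Sum.elim a b s).ofLp r, d, hd, ?_, ?_⟩
  · ext r s
    rw [orthonormal_iff_ite] at ho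
    have := ho r s
    rw [hin] at this
    rw [one_apply, ← this]
    rfl
  · ext r s
    rcases s with s | s
    · have := congrArg (fun v : EuclideanSpace ℝ (Idx n) => v.ofLp r) (ha s)
      rw [mul_apply, mul_apply]
      simpa [toLpLin_apply, mulVec, dotProduct, JJ, dblDiag, fromBlocks_multiply,
        diagonal_apply, Fintype.sum_sum_type, mul_comm, -fromBlocks_diagonal] using this
    · have := congrArg (fun v : EuclideanSpace ℝ (Idx n) => v.ofLp r) (hb s)
      rw [mul_apply, mul_apply]
      simpa [toLpLin_apply, mulVec, dotProduct, JJ, dblDiag, fromBlocks_multiply,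
        diagonal_apply, Fintype.sum_sum_type, mul_comm, -fromBlocks_diagonal] using this

/-! ### Williamson's theorem -/

open scoped MatrixOrder Matrix.Norms.L2Operator in
theorem _root_.Matrix.PosDef.exists_transpose_mul_self {m : Type*} [Fintype m] [DecidableEq m]
    {Q : Matrix m m ℝ} (hQ : Q.PosDef) : ∃ R : Matrix m m ℝ, Q = Rᵀ * R := by
  obtain ⟨R, hR⟩ := CStarAlgebra.nonneg_iff_eq_star_mul_self.mp hQ.posSemidef.nonneg
  exact ⟨R, by rwa [star_eq_conjTranspose, conjTranspose_eq_transpose_of_trivial] at hR⟩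

/-- Williamson's theorem. -/
theorem exists_williamson {n : ℕ} {Q : Matrix (Idx n) (Idx n) ℝ} (hQ : Q.PosDef) :
    ∃ (d : Fin n → ℝ) (S : Matrix (Idx n) (Idx n) ℝ), (∀ i, 0 < d i) ∧
      S ∈ symplecticGroup (Fin n) ℝ ∧ Q = Sᵀ * dblDiag d * S := by
  obtain ⟨R, rfl⟩ := hQ.exists_transpose_mul_self
  have hR : IsUnit R := isUnit_of_mul_isUnit_right hQ.isUnit
  have hRt : IsUnit Rᵀ := (isUnit_transpose R).2 hR
  -- With Q = RᵀR, the matrix R𝕁Rᵀ is skew and invertible; its normal form supplies the parameters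
  -- d.
  obtain ⟨U, d, hd, hU, hKU⟩ := exists_orthogonal_skew (R * JJ n * Rᵀ)
    (by simp [transpose_mul, JJ_transpose, Matrix.mul_assoc]) ((hR.mul (isUnit_JJ n)).mul hRt)
  have hU' : U * Uᵀ = 1 := mul_eq_one_comm.1 hU
  set E := dblDiag fun i => (Real.sqrt (d i))⁻¹ with hE
  have hEt : Eᵀ = E := dblDiag_transpose _
  have hs (i) : Real.sqrt (d i) ≠ 0 := (Real.sqrt_pos.2 (hd i)).ne'
  have hmul (f g : Fin n → ℝ) : dblDiag f * dblDiag g = dblDiag fun i => f i * g i := by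
    rw [dblDiag_eq, dblDiag_eq, dblDiag_eq, diagonal_mul_diagonal]
    congr 1; ext (i | i) <;> rfl
  have hone : dblDiag (fun _ : Fin n => (1 : ℝ)) = 1 := by
    rw [dblDiag_eq, ← diagonal_one]
    congr 1; ext (i | i) <;> rfl
  have hEDE : E * dblDiag d * E = 1 := by
    rw [hE, hmul, hmul, ← hone]
    congr 1
    ext i
    have := hs i
    have h2 := Real.mul_self_sqrt (hd i).le
    field_simp
    nlinarith
  -- Here E = D̂^(-1/2). Then S𝕁Sᵀ = E𝕁D̂E = 𝕁, which makes Sᵀ, hence S, symplectic, and SᵀD̂S =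
  -- RᵀU(ED̂E)UᵀR = RᵀR.
  refine ⟨d, E * Uᵀ * R, hd, ?_, ?_⟩
  · rw [← SymplecticGroup.transpose_mem_iff, mem_symplecticGroup_iff]
    have e1 : E * Uᵀ * R * JJ n * (E * Uᵀ * R)ᵀ = E * (Uᵀ * ((R * JJ n * Rᵀ) * U)) * E := by
      simp only [transpose_mul, transpose_transpose, hEt, Matrix.mul_assoc]
    rw [transpose_transpose, e1, hKU, ← Matrix.mul_assoc Uᵀ, hU, Matrix.one_mul,
      ← Matrix.mul_assoc, hE, ← JJ_mul_dblDiag_comm, ← hE, Matrix.mul_assoc, Matrix.mul_assoc,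
      ← Matrix.mul_assoc E, hEDE, Matrix.mul_one]
  · have e1 : (E * Uᵀ * R)ᵀ * dblDiag d * (E * Uᵀ * R)
        = Rᵀ * (U * ((E * dblDiag d * E) * Uᵀ)) * R := by
      simp only [transpose_mul, transpose_transpose, hEt, Matrix.mul_assoc]
    rw [e1, hEDE, Matrix.one_mul, hU', Matrix.mul_one]

/-! ### Properness of the Williamson parametrization -/

open Filter Topology in
theorem exists_tendsto_of_eventually_abs_le {X : Type*} (g : Ultrafilter X) {f : X → ℝ} {C : ℝ}
    (h : ∀ᶠ x in (g : Filter X), |f x| ≤ C) : ∃ l, Tendsto f g (𝓝 l) := by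
  obtain ⟨l, -, hl⟩ := (isCompact_Icc (a := -C) (b := C)).ultrafilter_le_nhds (g.map f)
    (le_principal_iff.2 (h.mono fun x hx => abs_le.1 hx))
  exact ⟨l, hl⟩

theorem det_dblDiag {n : ℕ} (d : Fin n → ℝ) : (dblDiag d).det = (∏ i, d i) ^ 2 := by
  rw [dblDiag, det_fromBlocks_zero₂₁, det_diagonal, pow_two]

theorem det_mul_self_of_mem_symplecticGroup {n : ℕ} {S : Matrix (Idx n) (Idx n) ℝ}
    (hS : S ∈ symplecticGroup (Fin n) ℝ) : S.det * S.det = 1 := by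
  have h := congrArg det (mul_JJ_mul_transpose hS)
  have hJ : (JJ n).det ≠ 0 := ((isUnit_iff_isUnit_det _).1 (isUnit_JJ n)).ne_zero
  rw [det_mul, det_mul, det_transpose] at h
  exact mul_right_cancel₀ hJ (by linarith)

/-- Since det S squares to 1, the determinant of Q fixes the product of the d i; this prevents their
limits from vanishing. -/
theorem det_williamson {n : ℕ} {S : Matrix (Idx n) (Idx n) ℝ} (d : Fin n → ℝ)
    (hS : S ∈ symplecticGroup (Fin n) ℝ) : (Sᵀ * dblDiag d * S).det = (∏ i, d i) ^ 2 := by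
  rw [det_mul, det_mul, det_transpose, ← det_dblDiag]
  linear_combination (dblDiag d).det * det_mul_self_of_mem_symplecticGroup hS

/-- Cyclicity of the trace and S𝕁Sᵀ = 𝕁 reduce 𝕁Q to 𝕁D̂. The resulting identity bounds every d i in
terms of Q alone. -/
theorem trace_williamson {n : ℕ} {S : Matrix (Idx n) (Idx n) ℝ} (d : Fin n → ℝ)
    (hS : S ∈ symplecticGroup (Fin n) ℝ) :
    ((JJ n * (Sᵀ * dblDiag d * S)) * (JJ n * (Sᵀ * dblDiag d * S))).trace
      = -(2 * ∑ i, d i ^ 2) := by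
  have hJ := mul_JJ_mul_transpose hS
  have h1 : (JJ n * (Sᵀ * dblDiag d * S)) * (JJ n * (Sᵀ * dblDiag d * S))
      = (JJ n * Sᵀ * dblDiag d * (S * JJ n * Sᵀ) * dblDiag d) * S := by
    simp only [Matrix.mul_assoc]
  have h2 : S * (JJ n * Sᵀ * dblDiag d * (S * JJ n * Sᵀ) * dblDiag d)
      = (S * JJ n * Sᵀ) * dblDiag d * ((S * JJ n * Sᵀ) * dblDiag d) := by
    simp only [Matrix.mul_assoc]
  rw [h1, trace_mul_comm, h2, hJ, JJ_mul_dblDiag_sq, trace_neg, dblDiag_eq, trace_diagonal,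
    Fintype.sum_sum_type]
  simp [two_mul]

/-- All summands are nonnegative when d is, so a positive lower bound on d turns a diagonal entry of
Q into a bound on a column of S. -/
theorem williamson_apply_self {n : ℕ} (d : Fin n → ℝ) (S : Matrix (Idx n) (Idx n) ℝ)
    (j : Idx n) : (Sᵀ * dblDiag d * S) j j = ∑ i, Sum.elim d d i * S i j ^ 2 := by
  rw [dblDiag_eq, mul_apply]
  simp only [mul_diagonal, transpose_apply]
  exact Finset.sum_congr rfl fun i _ => by ring

open Filter Topology in
/-- Properness of `(d, S) ↦ Sᵀ D̂ S`: if the images converge along an ultrafilter to a positive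
definite matrix, then so do the arguments, with positive limit parameters. -/
theorem exists_tendsto_of_tendsto_williamson {n : ℕ} {X : Type*} (g : Ultrafilter X)
    {d : X → Fin n → ℝ} {S : X → Matrix (Idx n) (Idx n) ℝ} {Q : Matrix (Idx n) (Idx n) ℝ}
    (hd : ∀ x i, 0 < d x i) (hS : ∀ x, S x ∈ symplecticGroup (Fin n) ℝ) (hQ : Q.PosDef)
    (h : Tendsto (fun x => (S x)ᵀ * dblDiag (d x) * S x) g (𝓝 Q)) :
    ∃ d₀ S₀, (∀ i, 0 < d₀ i) ∧ Tendsto d g (𝓝 d₀) ∧ Tendsto S g (𝓝 S₀) := by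
  have hbd : ∀ i, ∃ l, Tendsto (fun x => d x i) g (𝓝 l) := by
    intro i
    have hc : Continuous fun M : Matrix (Idx n) (Idx n) ℝ => -((JJ n * M) * (JJ n * M)).trace := by
      fun_prop
    have h1 := ((hc.tendsto Q).comp h).eventually_le_const (lt_add_one _)
    -- The first 1 is slack for the eventual bound on the trace; the second comes from t ≤ t² + 1.
    refine exists_tendsto_of_eventually_abs_le g
      (C := -((JJ n * Q) * (JJ n * Q)).trace + 1 + 1) (h1.mono fun x hx => ?_)
    simp only [Function.comp, trace_williamson _ (hS x)] at hx
    have h2 := Finset.single_le_sum (f := fun i => d x i ^ 2) (fun i _ => sq_nonneg _)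
      (Finset.mem_univ i)
    have := hd x i
    rw [abs_of_pos this]
    nlinarith [sq_nonneg (d x i - 1)]
  choose d₀ hd₀ using hbd
  have hpos : ∀ i, 0 < d₀ i := by
    have h1 : Tendsto (fun x => (∏ i, d x i) ^ 2) g (𝓝 ((∏ i, d₀ i) ^ 2)) :=
      (tendsto_finsetProd _ fun i _ => hd₀ i).pow 2
    have h2 : Tendsto (fun x => (∏ i, d x i) ^ 2) g (𝓝 Q.det) := by
      have := ((continuous_id.matrix_det).tendsto Q).comp h
      refine this.congr fun x => ?_
      exact det_williamson _ (hS x)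
    have h3 := hQ.det_pos
    rw [← tendsto_nhds_unique h1 h2] at h3
    intro i
    refine (ge_of_tendsto' (hd₀ i) fun x => (hd x i).le).lt_of_ne' fun h0 => ?_
    rw [Finset.prod_eq_zero (Finset.mem_univ i) h0] at h3
    simp at h3
  have hbS : ∀ i j, ∃ l, Tendsto (fun x => S x i j) g (𝓝 l) := by
    intro i j
    have hi : Tendsto (fun x => Sum.elim (d x) (d x) i) g (𝓝 (Sum.elim d₀ d₀ i)) := by
      rcases i with i | i <;> exact hd₀ i
    have hip : 0 < Sum.elim d₀ d₀ i := by rcases i with i | i <;> exact hpos i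
    -- Half the positive limit is an eventual lower bound for the weight of S i j ^ 2.
    have h1 := hi.eventually_const_le (half_lt_self hip)
    have hc : Continuous fun M : Matrix (Idx n) (Idx n) ℝ => M j j := by fun_prop
    have h2 := ((hc.tendsto Q).comp h).eventually_le_const (lt_add_one _)
    refine exists_tendsto_of_eventually_abs_le g (C := (Q j j + 1) / (Sum.elim d₀ d₀ i / 2) + 1)
      ((h1.and h2).mono fun x hx => ?_)
    obtain ⟨hx1, hx2⟩ := hx
    simp only [Function.comp, williamson_apply_self] at hx2
    have h3 := (Finset.single_le_sum (f := fun i => Sum.elim (d x) (d x) i * S x i j ^ 2)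
      (fun i _ => mul_nonneg (by rcases i with i | i <;> exact (hd x i).le) (sq_nonneg _))
      (Finset.mem_univ i)).trans hx2
    have h4 : S x i j ^ 2 ≤ (Q j j + 1) / (Sum.elim d₀ d₀ i / 2) := by
      rw [le_div_iff₀ (half_pos hip), mul_comm]
      exact (mul_le_mul_of_nonneg_right hx1 (sq_nonneg _)).trans h3
    rw [abs_le]
    constructor <;> nlinarith [sq_nonneg (S x i j - 1), sq_nonneg (S x i j + 1)]
  choose S₀ hS₀ using hbS
  exact ⟨d₀, S₀, hpos, tendsto_pi_nhds.2 hd₀,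
    tendsto_pi_nhds.2 fun i => tendsto_pi_nhds.2 fun j => hS₀ i j⟩

/-! ### The quotient map and its inverse -/

theorem continuous_dblDiag (n : ℕ) : Continuous (dblDiag (n := n)) := by
  unfold dblDiag
  fun_prop

open Filter Topology in
theorem tendsto_williamson {n : ℕ} {X : Type*} {l : Filter X} {d : X → Fin n → ℝ}
    {S : X → Matrix (Idx n) (Idx n) ℝ} {d₀ : Fin n → ℝ} {S₀ : Matrix (Idx n) (Idx n) ℝ}
    (hd : Tendsto d l (𝓝 d₀)) (hS : Tendsto S l (𝓝 S₀)) :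
    Tendsto (fun x => (S x)ᵀ * dblDiag (d x) * S x) l (𝓝 (S₀ᵀ * dblDiag d₀ * S₀)) := by
  have hc : Continuous fun M : Matrix (Idx n) (Idx n) ℝ × Matrix (Idx n) (Idx n) ℝ =>
      M.1ᵀ * M.2 * M.1 := by fun_prop
  have h1 := hS.prodMk_nhds (((continuous_dblDiag n).tendsto d₀).comp hd)
  have h2 := (hc.tendsto (S₀, dblDiag d₀)).comp h1
  simpa only [Function.comp_def] using h2

theorem continuous_diagPH (n : ℕ) : Continuous (diagPH (n := n)) := by
  unfold diagPH
  refine Continuous.subtype_mk ?_ _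
  exact ((continuous_dblDiag n).comp (by fun_prop)).prodMk (by fun_prop)

/-- The map on quotients induced by `(d, v) ↦ (D̂, v)`. -/
def quotMap (n : ℕ) : ThetaQuot n → PHQuot n :=
  Quotient.map diagPH fun _ _ h => SimStar.simSys_diagPH h

theorem quotMap_mk_eq_phiTheta {n : ℕ} (S : symplecticGroup (Fin n) ℝ) (p : ThetaCH n) :
    quotMap n (Quotient.mk _ p) = Quotient.mk (simSysSetoid n) (phiTheta S p) :=
  (Quotient.sound (simSys_phiTheta_diagPH S p)).symm

theorem continuous_quotMap (n : ℕ) : Continuous (quotMap n) :=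
  (continuous_diagPH n).quotient_map' _

theorem quotMap_injective (n : ℕ) : Function.Injective (quotMap n) := by
  rintro ⟨p⟩ ⟨q⟩ h
  exact Quotient.sound (SimStar.of_simSys_diagPH (Quotient.exact h))

theorem exists_eq_phiTheta {n : ℕ} (x : PH n) :
    ∃ (S : symplecticGroup (Fin n) ℝ) (p : ThetaCH n), x = phiTheta S p := by
  obtain ⟨⟨Q, B⟩, hQ⟩ := x
  obtain ⟨d, S, hd, hS, rfl⟩ := exists_williamson hQ
  refine ⟨⟨S, hS⟩, ⟨(d, S *ᵥ B), hd⟩, Subtype.ext (Prod.ext rfl ?_)⟩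
  simp [phiTheta, mulVec_mulVec, nonsing_inv_mul S (SymplecticGroup.symplectic_det hS)]

open Filter Topology in
/-- A right inverse of `quotMap` on the level of systems is automatically continuous. -/
theorem continuous_of_quotMap_eq_mk {n : ℕ} {Ψ : PH n → ThetaQuot n}
    (hΨ : ∀ x, quotMap n (Ψ x) = Quotient.mk _ x) : Continuous Ψ := by
  -- These choices carry no continuity; only the class of `p x` is determined by x.
  choose S p hp using exists_eq_phiTheta (n := n)
  have hval (x : PH n) : Ψ x = Quotient.mk _ (p x) := by
    apply quotMap_injective
    rw [hΨ, quotMap_mk_eq_phiTheta (S x), ← hp x]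
  have hQ (x : PH n) : x.1.1 = (S x).1ᵀ * dblDiag (p x).1.1 * (S x).1 :=
    congrArg (fun y : PH n => y.1.1) (hp x)
  have hB (x : PH n) : (p x).1.2 = (S x).1 *ᵥ x.1.2 := by
    have : x.1.2 = (S x).1⁻¹ *ᵥ (p x).1.2 := congrArg (fun y : PH n => y.1.2) (hp x)
    rw [this, mulVec_mulVec, mul_nonsing_inv _ (SymplecticGroup.symplectic_det (S x).2),
      one_mulVec]
  rw [continuous_iff_ultrafilter]
  intro x g hg
  have hx : Tendsto (fun y : PH n => y) g (𝓝 x) := hg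
  have hxQ : Tendsto (fun y : PH n => y.1.1) g (𝓝 x.1.1) :=
    ((by fun_prop : Continuous fun y : PH n => y.1.1).tendsto x).comp hx
  have hxB : Tendsto (fun y : PH n => y.1.2) g (𝓝 x.1.2) :=
    ((by fun_prop : Continuous fun y : PH n => y.1.2).tendsto x).comp hx
  obtain ⟨d₀, S₀, hd₀, htd, htS⟩ := exists_tendsto_of_tendsto_williamson g
    (d := fun y => (p y).1.1) (S := fun y => (S y).1) (fun y => (p y).2) (fun y => (S y).2) x.2
    (hxQ.congr hQ)
  have hS₀ : S₀ ∈ symplecticGroup (Fin n) ℝ := by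
    rw [mem_symplecticGroup_iff]
    have hc : Continuous fun M : Matrix (Idx n) (Idx n) ℝ => Mᵀ * JJ n * M := by fun_prop
    exact tendsto_nhds_unique ((hc.tendsto S₀).comp htS)
      (tendsto_const_nhds.congr fun y => ((mem_symplecticGroup_iff _).1 (S y).2).symm)
  have hQ₀ : x.1.1 = S₀ᵀ * dblDiag d₀ * S₀ := by
    exact tendsto_nhds_unique (hxQ.congr hQ) (tendsto_williamson htd htS)
  set p₀ : ThetaCH n := ⟨(d₀, S₀ *ᵥ x.1.2), hd₀⟩ with hp₀
  have hxp : x = phiTheta ⟨S₀, hS₀⟩ p₀ := by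
    refine Subtype.ext (Prod.ext hQ₀ ?_)
    simp [phiTheta, hp₀, mulVec_mulVec,
      nonsing_inv_mul S₀ (SymplecticGroup.symplectic_det hS₀)]
  -- The limit data p₀ may differ from the chosen `p x`, but both represent Ψ x by injectivity.
  have hΨx : Ψ x = Quotient.mk _ p₀ := by
    apply quotMap_injective
    rw [hΨ, quotMap_mk_eq_phiTheta ⟨S₀, hS₀⟩, ← hxp]
  have hv : Tendsto (fun y : PH n => (p y).1.2) g (𝓝 (S₀ *ᵥ x.1.2)) := by
    have hc : Continuous fun M : Matrix (Idx n) (Idx n) ℝ × (Idx n → ℝ) => M.1 *ᵥ M.2 :=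
      continuous_fst.matrix_mulVec continuous_snd
    exact (((hc.tendsto (S₀, x.1.2)).comp (htS.prodMk_nhds hxB))).congr fun y => (hB y).symm
  have htp : Tendsto p g (𝓝 p₀) := tendsto_subtype_rng.2 (htd.prodMk_nhds hv)
  rw [hΨx]
  exact ((continuous_quotient_mk'.tendsto p₀).comp htp).congr fun y => (hval y).symm

theorem quotMap_surjective (n : ℕ) : Function.Surjective (quotMap n) := by
  rintro ⟨x⟩
  obtain ⟨S, p, rfl⟩ := exists_eq_phiTheta x
  exact ⟨Quotient.mk _ p, quotMap_mk_eq_phiTheta S p⟩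

theorem isHomeomorph_quotMap (n : ℕ) : IsHomeomorph (quotMap n) := by
  refine isHomeomorph_iff_exists_inverse.2 ⟨continuous_quotMap n,
    Function.surjInv (quotMap_surjective n),
    Function.leftInverse_surjInv ⟨quotMap_injective n, quotMap_surjective n⟩,
    Function.rightInverse_surjInv _, ?_⟩
  -- Continuity on the quotient is tested after composing with the projection from `PH n`.
  refine (isQuotientMap_quotient_mk').continuous_iff.2 ?_
  exact continuous_of_quotMap_eq_mk fun x => Function.surjInv_eq _ _

end PortHam

theorem theorem4p6 (n : ℕ) :
    (∀ (S : Matrix.symplecticGroup (Fin n) ℝ) (p q : PortHam.ThetaCH n),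
      PortHam.SimStar p q →
        PortHam.SimSys (PortHam.phiTheta S p) (PortHam.phiTheta S q)) ∧
    ∃ Φ : PortHam.ThetaQuot n → PortHam.PHQuot n,
      (∀ (S : Matrix.symplecticGroup (Fin n) ℝ) (p : PortHam.ThetaCH n),
        Φ (Quotient.mk (PortHam.simStarSetoid n) p) =
          Quotient.mk (PortHam.simSysSetoid n) (PortHam.phiTheta S p)) ∧
      (∀ p : PortHam.ThetaCH n,
        Φ (Quotient.mk (PortHam.simStarSetoid n) p) =
          Quotient.mk (PortHam.simSysSetoid n) (PortHam.diagPH p)) ∧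
      Function.Bijective Φ ∧ IsHomeomorph Φ := by
  have he := PortHam.simSys_equivalence n
  refine ⟨fun S p q h => ?_, PortHam.quotMap n, PortHam.quotMap_mk_eq_phiTheta, fun _ => rfl,
    ⟨PortHam.quotMap_injective n, PortHam.quotMap_surjective n⟩, PortHam.isHomeomorph_quotMap n⟩
  -- Both images are compared through their diagonal representatives, where S no longer occurs.
  exact he.trans (PortHam.simSys_phiTheta_diagPH S p)
    (he.trans h.simSys_diagPH (he.symm (PortHam.simSys_phiTheta_diagPH S q)))
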